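/- Let $\mathbb{K}$ be a commutative unital ring, and let $\mathrm{DGAlg}$ be the category of dg algebras over $\mathbb{K}$: the objects are cochain complexes of $\mathbb{K}$-modules $A=(A^n,d^n)_{n\in\mathbb{Z}}$ with a unital associative $\mathbb{K}$-bilinear multiplication $A^i\times A^j\to A^{i+j}$ satisfying $d(ab)=d(a)b+(-1)^{|a|}a\,d(b)$, and the morphisms are the cochain maps that preserve products and the unit. Let $\mathcal{Q}uas$ be the class of quasi-isomorphisms in $\mathrm{DGAlg}$ (morphisms inducing isomorphisms on all cohomology modules $H^n$), let $\mathcal{S}urj$ be the class of morphisms that are surjective in every degree, and let $\mathcal{C}of$ be the class of morphisms with the left lifting property against every morphism in $\mathcal{Q}uas\cap\mathcal{S}urj$. Then $(\mathcal{C}of,\mathcal{Q}uas,\mathcal{S}urj)$ is a model structure on $\mathrm{DGAlg}$, with $\mathcal{C}of$ as cofibrations, $\mathcal{Q}uas$ as weak equivalences and $\mathcal{S}urj$ as fibrations. That is: $\mathrm{DGAlg}$ has finite limits and finite colimits; each of the three classes contains all identities and is closed under compositions and retracts; if two of $f$, $g$, $g\circ f$ lie in $\mathcal{Q}uas$, so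 does the third; morphisms in $\mathcal{C}of$ have the left lifting property against $\mathcal{Q}uas\cap\mathcal{S}urj$, and morphisms in $\mathcal{C}of\cap\mathcal{Q}uas$ have it against $\mathcal{S}urj$; and every morphism $f$ factors both as $f=p\circ i$ with $i\in\mathcal{C}of$, $p\in\mathcal{Q}uas\cap\mathcal{S}urj$, and as $f=q\circ j$ with $j\in\mathcal{C}of\cap\mathcal{Q}uas$, $q\in\mathcal{S}urj$. -/

import Mathlib

open CategoryTheory

universe u

/-- A differential graded unital associative algebra over `K` (cohomological `ℤ`-grading): a cochain
complex of `K`-modules with a unital associative `K`-bilinear multiplication that is additive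
on degrees and satisfies the graded Leibniz rule. The product of elements of degrees `i` and `j` is
indexed by a proof that `i + j = k`, so that the laws need no transport between degrees. -/
structure DGAlg (K : Type u) [CommRing K] where
  /-- the underlying cochain complex -/
  cx : CochainComplex (ModuleCat.{u} K) ℤ
  /-- the multiplication, degree by degree -/
  mul {i j k : ℤ} (h : i + j = k) : cx.X i →ₗ[K] cx.X j →ₗ[K] cx.X k
  /-- the unit -/
  one : cx.X 0
  one_mul {i : ℤ} (a : cx.X i) : mul (zero_add i) one a = a
  mul_one {i : ℤ} (a : cx.X i) : mul (add_zero i) a one = a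
  mul_assoc {i j k ij jk n : ℤ} (hij : i + j = ij) (hjk : j + k = jk)
    (h₁ : ij + k = n) (h₂ : i + jk = n) (a : cx.X i) (b : cx.X j) (c : cx.X k) :
    mul h₁ (mul hij a b) c = mul h₂ a (mul hjk b c)
  /-- `d (a b) = (d a) b + (-1) ^ |a| a (d b)` -/
  leibniz {i j k : ℤ} (h : i + j = k) (a : cx.X i) (b : cx.X j) :
    (cx.d k (k + 1)).hom (mul h a b) =
      mul (show (i + 1) + j = k + 1 by omega) ((cx.d i (i + 1)).hom a) b +
        i.negOnePow • mul (show i + (j + 1) = k + 1 by omega) a ((cx.d j (j + 1)).hom b)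

namespace DGAlg

variable {K : Type u} [CommRing K]

/-- A homomorphism of dg algebras: a cochain map preserving products and the unit. -/
@[ext]
structure Hom (A B : DGAlg K) where
  /-- the underlying cochain map -/
  map : A.cx ⟶ B.cx
  map_mul {i j k : ℤ} (h : i + j = k) (a : A.cx.X i) (b : A.cx.X j) :
    (map.f k).hom (A.mul h a b) = B.mul h ((map.f i).hom a) ((map.f j).hom b)
  map_one : (map.f 0).hom A.one = B.one

/-- The category of dg algebras over `K`. -/
instance : Category (DGAlg K) where
  Hom := Hom
  id A := { map := 𝟙 A.cx, map_mul := by simp, map_one := by simp }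
  comp f g :=
    { map := f.map ≫ g.map
      map_mul := by simp [f.map_mul, g.map_mul]
      map_one := by simp [f.map_one, g.map_one] }

variable (K)

/-- The functor sending a dg algebra to its underlying cochain complex of `K`-modules. -/
def toComplex : DGAlg K ⥤ CochainComplex (ModuleCat.{u} K) ℤ where
  obj A := A.cx
  map f := Hom.map f

/-- Quasi-isomorphisms: homomorphisms inducing isomorphisms on all cohomology modules. -/
def quasiIsos : MorphismProperty (DGAlg K) :=
  (HomologicalComplex.quasiIso (ModuleCat.{u} K) (ComplexShape.up ℤ)).inverseImage (toComplex K)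

/-- Surjective homomorphisms: those that are surjective in every degree. -/
def surjections : MorphismProperty (DGAlg K) :=
  fun _ _ f => ∀ n : ℤ, Function.Surjective (((toComplex K).map f).f n).hom

/-- Cofibrations: homomorphisms with the left lifting property against all surjective
quasi-isomorphisms. -/
def cofibs : MorphismProperty (DGAlg K) :=
  (quasiIsos K ⊓ surjections K).llp

end DGAlg

/-! Surjections and surjective quasi-isomorphisms are both characterized by a filling condition
`HasFillers w`: a prescribed image, together with a prescribed differential when `w` holds, can be
realized upstairs. For a fixed `f`, the factorizations of `f` whose second factor carries a choice
of fillers have a universal one, generated by `A` under the dg operations and the filler operation.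
Its second factor has fillers. Its first factor lifts against every map with fillers, because the
pullback of such a map along `univ w f ⟶ Y` can be given fillers lying over the universal ones
(`hasLiftingProperty_inl`). No small object argument is needed. Free objects, and colimits likewise,
are found inside the product of all models, as the set of values of terms. The product is large, but
the terms form a small type; relations hold because they hold in every model. It remains to see that
a map `j` lifting against all surjections is a quasi-isomorphism. Lifting against `A ⟶ 0` gives a
retraction `r`. Lifting against the projection of a mapping path algebra gives a homotopy between
the identity and `r ≫ j` (`quasiIsos_of_llp_surjections`). The retract argument then identifies
acyclic cofibrations with the maps that lift against surjections. -/

namespace DGAlg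

/-! ### Elementwise calculus in dg algebras -/

section Basics

variable {K : Type u} [CommRing K]

/-- The `K`-linear map given by a homomorphism of dg algebras in degree `n`. -/
def app {A B : DGAlg K} (f : A ⟶ B) (n : ℤ) : A.cx.X n →ₗ[K] B.cx.X n :=
  (((toComplex K).map f).f n).hom

/-- The differential of a dg algebra as a linear map. -/
def δ (A : DGAlg K) (i j : ℤ) : A.cx.X i →ₗ[K] A.cx.X j :=
  (A.cx.d i j).hom

lemma δ_δ (A : DGAlg K) (i j k : ℤ) (a : A.cx.X i) : A.δ j k (A.δ i j a) = 0 := by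
  have := A.cx.d_comp_d i j k
  exact congr($(this).hom a)

lemma δ_eq_zero (A : DGAlg K) {i j : ℤ} (h : i + 1 ≠ j) : A.δ i j = 0 := by
  have := A.cx.shape i j (by simpa using h)
  exact congr($(this).hom)

lemma δ_mul (A : DGAlg K) {i j k i' j' k' : ℤ} (h : i + j = k) (hi : i + 1 = i') (hj : j + 1 = j')
    (hk : k + 1 = k') (a : A.cx.X i) (b : A.cx.X j) :
    A.δ k k' (A.mul h a b) = A.mul (by omega) (A.δ i i' a) b +
      i.negOnePow • A.mul (by omega) a (A.δ j j' b) := by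
  subst hi hj hk
  exact A.leibniz h a b

lemma app_δ {A B : DGAlg K} (f : A ⟶ B) (i j : ℤ) (a : A.cx.X i) :
    app f j (A.δ i j a) = B.δ i j (app f i a) := by
  have := ((toComplex K).map f).comm i j
  exact congr($(this.symm).hom a)

lemma app_mul {A B : DGAlg K} (f : A ⟶ B) {i j k : ℤ} (h : i + j = k) (a : A.cx.X i)
    (b : A.cx.X j) : app f k (A.mul h a b) = B.mul h (app f i a) (app f j b) :=
  Hom.map_mul f h a b

lemma app_one {A B : DGAlg K} (f : A ⟶ B) : app f 0 A.one = B.one :=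
  Hom.map_one f

@[simp]
lemma app_id (A : DGAlg K) (n : ℤ) (a : A.cx.X n) : app (𝟙 A) n a = a := rfl

@[simp]
lemma app_comp {A B C : DGAlg K} (f : A ⟶ B) (g : B ⟶ C) (n : ℤ) (a : A.cx.X n) :
    app (f ≫ g) n a = app g n (app f n a) := rfl

lemma hom_ext {A B : DGAlg K} {f g : A ⟶ B} (h : ∀ n a, app f n a = app g n a) : f = g :=
  Hom.ext (by ext n a; exact h n a)

/-- Constructor for homomorphisms of dg algebras. -/
def ofLinear {A B : DGAlg K} (φ : ∀ n, A.cx.X n →ₗ[K] B.cx.X n)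
    (hd : ∀ i a, φ (i + 1) (A.δ i (i + 1) a) = B.δ i (i + 1) (φ i a))
    (hmul : ∀ {i j k : ℤ} (h : i + j = k) a b, φ k (A.mul h a b) = B.mul h (φ i a) (φ j b))
    (hone : φ 0 A.one = B.one) : A ⟶ B :=
  Hom.mk
    { f n := ModuleCat.ofHom (φ n)
      comm' i j h := by
        obtain rfl : i + 1 = j := h
        ext a
        exact (hd i a).symm }
    hmul hone

end Basics

universe w

/-! ### Small dg subalgebras of large products -/

section SubProduct

variable {K : Type u} [CommRing K]

/-- A graded submodule, with small components, of the product of a (possibly large) family of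
dg algebras that is closed under differential and products and contains the unit. -/
structure SubProduct {I : Type w} (X : I → DGAlg K) where
  /-- the components -/
  carrier (n : ℤ) : Submodule K (∀ i, (X i).cx.X n)
  small (n : ℤ) : Small.{u} (carrier n)
  d_mem {n : ℤ} {s : ∀ i, (X i).cx.X n} (hs : s ∈ carrier n) :
    (fun i => (X i).δ n (n + 1) (s i)) ∈ carrier (n + 1)
  mul_mem {m n k : ℤ} (h : m + n = k) {s : ∀ i, (X i).cx.X m} {t : ∀ i, (X i).cx.X n}
    (hs : s ∈ carrier m) (ht : t ∈ carrier n) : (fun i => (X i).mul h (s i) (t i)) ∈ carrier k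
  one_mem : (fun i => (X i).one) ∈ carrier 0

namespace SubProduct

attribute [instance] SubProduct.small

variable {I : Type w} {X : I → DGAlg K} (S : SubProduct X)

lemma d_mem' {m n : ℤ} {s : ∀ i, (X i).cx.X m} (hs : s ∈ S.carrier m) :
    (fun i => (X i).δ m n (s i)) ∈ S.carrier n := by
  by_cases h : m + 1 = n
  · subst h
    exact S.d_mem hs
  · have : (fun i => (X i).δ m n (s i)) = 0 := by
      funext i
      simp [(X i).δ_eq_zero h]
    rw [this]
    exact Submodule.zero_mem _

/-- The component of degree `n`, in the right universe. -/
abbrev Comp (n : ℤ) : Type u := Shrink.{u} (S.carrier n)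

/-- The coordinates of an element. -/
noncomputable def coord (i : I) (n : ℤ) : S.Comp n →ₗ[K] (X i).cx.X n :=
  (LinearMap.proj i ∘ₗ (S.carrier n).subtype) ∘ₗ (Shrink.linearEquiv K (S.carrier n)).toLinearMap

/-- The element with given coordinates. -/
noncomputable def ofCoord {n : ℤ} (s : ∀ i, (X i).cx.X n) (hs : s ∈ S.carrier n) : S.Comp n :=
  (Shrink.linearEquiv K (S.carrier n)).symm ⟨s, hs⟩

@[simp]
lemma coord_ofCoord {n : ℤ} (s : ∀ i, (X i).cx.X n) (hs : s ∈ S.carrier n) (i : I) :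
    S.coord i n (S.ofCoord s hs) = s i := by
  simp [coord, ofCoord]

lemma comp_ext {n : ℤ} {a b : S.Comp n} (h : ∀ i, S.coord i n a = S.coord i n b) : a = b := by
  apply (Shrink.linearEquiv K (S.carrier n)).injective
  apply Subtype.ext
  funext i
  exact h i

lemma coord_mem {n : ℤ} (a : S.Comp n) : (fun i => S.coord i n a) ∈ S.carrier n :=
  (Shrink.linearEquiv K (S.carrier n) a).2

/-- The differential. -/
noncomputable def d (m n : ℤ) : S.Comp m →ₗ[K] S.Comp n where
  toFun a := S.ofCoord (fun i => (X i).δ m n (S.coord i m a)) (S.d_mem' (S.coord_mem a))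
  map_add' a b := S.comp_ext fun i => by simp
  map_smul' r a := S.comp_ext fun i => by simp

@[simp]
lemma coord_d (i : I) (m n : ℤ) (a : S.Comp m) :
    S.coord i n (S.d m n a) = (X i).δ m n (S.coord i m a) :=
  S.coord_ofCoord _ _ i

/-- The multiplication. -/
noncomputable def mul {m n k : ℤ} (h : m + n = k) : S.Comp m →ₗ[K] S.Comp n →ₗ[K] S.Comp k :=
  LinearMap.mk₂ K
    (fun a b => S.ofCoord (fun i => (X i).mul h (S.coord i m a) (S.coord i n b))
      (S.mul_mem h (S.coord_mem a) (S.coord_mem b)))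
    (fun _ _ _ => S.comp_ext fun i => by simp) (fun _ _ _ => S.comp_ext fun i => by simp)
    (fun _ _ _ => S.comp_ext fun i => by simp) (fun _ _ _ => S.comp_ext fun i => by simp)

@[simp]
lemma coord_mul (i : I) {m n k : ℤ} (h : m + n = k) (a : S.Comp m) (b : S.Comp n) :
    S.coord i k (S.mul h a b) = (X i).mul h (S.coord i m a) (S.coord i n b) :=
  S.coord_ofCoord _ _ i

/-- The unit. -/
noncomputable def one : S.Comp 0 := S.ofCoord _ S.one_mem

@[simp]
lemma coord_one (i : I) : S.coord i 0 S.one = (X i).one :=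
  S.coord_ofCoord _ _ i

/-- The dg algebra given by a subproduct. -/
noncomputable def obj : DGAlg K where
  cx :=
    { X n := ModuleCat.of K (S.Comp n)
      d m n := ModuleCat.ofHom (S.d m n)
      shape m n h := by
        refine ModuleCat.hom_ext (LinearMap.ext fun a => ?_)
        refine S.comp_ext fun i => ?_
        simp [(X i).δ_eq_zero (i := m) (j := n) (by simpa using h)]
      d_comp_d' l m n _ _ := by
        refine ModuleCat.hom_ext (LinearMap.ext fun a => ?_)
        refine S.comp_ext fun i => ?_
        simp [δ_δ] }
  mul h := S.mul h
  one := S.one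
  one_mul a := S.comp_ext fun i => by
    rw [coord_mul, coord_one, DGAlg.one_mul]
  mul_one a := S.comp_ext fun i => by
    rw [coord_mul, coord_one, DGAlg.mul_one]
  mul_assoc hij hjk h₁ h₂ a b c := S.comp_ext fun i => by
    simp only [coord_mul]
    exact (X i).mul_assoc hij hjk h₁ h₂ _ _ _
  leibniz h a b := S.comp_ext fun i => by
    change S.coord i _ (S.d _ _ _) = S.coord i _ (S.mul _ (S.d _ _ _) _ + _ • S.mul _ _ (S.d _ _ _))
    simp only [coord_d, coord_mul, map_add, Units.smul_def, map_zsmul]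
    exact (X i).δ_mul h rfl rfl rfl _ _

/-- The projections. -/
noncomputable def π (i : I) : S.obj ⟶ X i :=
  ofLinear (fun n => S.coord i n) (fun _ a => S.coord_d i _ _ a) (fun h a b => S.coord_mul i h a b)
    (S.coord_one i)

lemma obj_ext {n : ℤ} {a b : S.obj.cx.X n} (h : ∀ i, app (S.π i) n a = app (S.π i) n b) : a = b :=
  S.comp_ext h

lemma app_π_mem {n : ℤ} (a : S.obj.cx.X n) : (fun i => app (S.π i) n a) ∈ S.carrier n :=
  S.coord_mem a

/-- The element with given coordinates. -/
noncomputable def elt {n : ℤ} (s : ∀ i, (X i).cx.X n) (hs : s ∈ S.carrier n) : S.obj.cx.X n :=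
  S.ofCoord s hs

@[simp]
lemma app_π_elt {n : ℤ} (s : ∀ i, (X i).cx.X n) (hs : s ∈ S.carrier n) (i : I) :
    app (S.π i) n (S.elt s hs) = s i :=
  S.coord_ofCoord _ _ i

lemma hom_obj_ext {Z : DGAlg K} {f g : Z ⟶ S.obj} (h : ∀ i, f ≫ S.π i = g ≫ S.π i) : f = g :=
  hom_ext fun n a => S.obj_ext fun i => by rw [← app_comp, ← app_comp, h]

/-- Homomorphisms to a subproduct. -/
noncomputable def lift {Z : DGAlg K} (f : ∀ i, Z ⟶ X i)
    (hf : ∀ n a, (fun i => app (f i) n a) ∈ S.carrier n) : Z ⟶ S.obj :=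
  ofLinear
    (fun n =>
      { toFun a := S.elt _ (hf n a)
        map_add' _ _ := S.obj_ext fun i => by simp
        map_smul' _ _ := S.obj_ext fun i => by simp })
    (fun _ _ => S.obj_ext fun i => by simp [app_δ])
    (fun _ _ _ => S.obj_ext fun i => by simp [app_mul])
    (S.obj_ext fun i => by simp [app_one])

@[simp]
lemma lift_π {Z : DGAlg K} (f : ∀ i, Z ⟶ X i)
    (hf : ∀ n a, (fun i => app (f i) n a) ∈ S.carrier n) (i : I) : S.lift f hf ≫ S.π i = f i :=
  hom_ext fun n a => by
    rw [app_comp]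
    exact S.app_π_elt _ (hf n a) i

end SubProduct

end SubProduct

/-! ### Free algebras with partial operations, as values of terms -/

section Terms

/-- Terms in generators `G`, the operations of dg algebras and additional operations that lower the
degree by one and depend on a parameter in `E`. -/
inductive Term (K : Type u) (G E : ℤ → Type u) : ℤ → Type u
  | gen {n : ℤ} (g : G n) : Term K G E n
  | one : Term K G E 0
  | zero {n : ℤ} : Term K G E n
  | add {n : ℤ} (s t : Term K G E n) : Term K G E n
  | smul {n : ℤ} (r : K) (t : Term K G E n) : Term K G E n
  | mul {m n k : ℤ} (h : m + n = k) (s : Term K G E m) (t : Term K G E n) : Term K G E k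
  | d {n : ℤ} (t : Term K G E n) : Term K G E (n + 1)
  | op {n : ℤ} (t : Term K G E (n + 1)) (e : E n) : Term K G E n

/-- An interpretation of generators and additional partial operations in a dg algebra. -/
structure Interp (K : Type u) [CommRing K] (G E : ℤ → Type u) where
  /-- the dg algebra -/
  alg : DGAlg K
  /-- the interpretation of the generators -/
  gen {n : ℤ} : G n → alg.cx.X n
  /-- the interpretation of the operations -/
  op {n : ℤ} : alg.cx.X (n + 1) → E n → alg.cx.X n
  /-- the domains of the operations -/
  dom {n : ℤ} : alg.cx.X (n + 1) → E n → Prop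

variable {K : Type u} [CommRing K] {G E : ℤ → Type u}

/-- The value of a term. -/
def Term.eval (M : Interp K G E) : {n : ℤ} → Term K G E n → M.alg.cx.X n
  | _, .gen g => M.gen g
  | _, .one => M.alg.one
  | _, .zero => 0
  | _, .add s t => s.eval M + t.eval M
  | _, .smul r t => r • t.eval M
  | _, .mul h s t => M.alg.mul h (s.eval M) (t.eval M)
  | _, .d t => M.alg.δ _ _ (t.eval M)
  | _, .op t e => M.op (t.eval M) e

/-- A term is valid if its operations are only applied within their domains. -/
def Term.Valid (M : Interp K G E) : {n : ℤ} → Term K G E n → Prop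
  | _, .gen _ => True
  | _, .one => True
  | _, .zero => True
  | _, .add s t => s.Valid M ∧ t.Valid M
  | _, .smul _ t => t.Valid M
  | _, .mul _ s t => s.Valid M ∧ t.Valid M
  | _, .d t => t.Valid M
  | _, .op t e => t.Valid M ∧ M.dom (t.eval M) e

namespace Interp

variable {I : Type w} (M : I → Interp K G E)

/-- The dg algebras of values of terms that are valid in all members of a family of
interpretations. -/
def values : SubProduct fun i => (M i).alg where
  carrier n :=
    { carrier := {s | ∃ t : Term K G E n, (∀ i, t.Valid (M i)) ∧ (fun i => t.eval (M i)) = s}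
      add_mem' := by
        rintro _ _ ⟨s, hs, rfl⟩ ⟨t, ht, rfl⟩
        exact ⟨.add s t, fun i => ⟨hs i, ht i⟩, rfl⟩
      zero_mem' := ⟨.zero, fun _ => trivial, rfl⟩
      smul_mem' := by
        rintro r _ ⟨t, ht, rfl⟩
        exact ⟨.smul r t, ht, rfl⟩ }
  -- The index type of the family may be large, but the terms live in `Type u` and surject onto the
  -- carrier.
  small n := by
    let φ : {t : Term K G E n // ∀ i, t.Valid (M i)} →
        {s : ∀ i, (M i).alg.cx.X n //
          ∃ t : Term K G E n, (∀ i, t.Valid (M i)) ∧ (fun i => t.eval (M i)) = s} :=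
      fun t => ⟨fun i => t.1.eval (M i), t.1, t.2, rfl⟩
    refine small_of_surjective (f := φ) ?_
    rintro ⟨_, t, ht, rfl⟩
    exact ⟨⟨t, ht⟩, rfl⟩
  d_mem := by
    rintro n _ ⟨t, ht, rfl⟩
    exact ⟨.d t, ht, rfl⟩
  mul_mem := by
    rintro m n k h _ _ ⟨s, hs, rfl⟩ ⟨t, ht, rfl⟩
    exact ⟨.mul h s t, fun i => ⟨hs i, ht i⟩, rfl⟩
  one_mem := ⟨.one, fun _ => trivial, rfl⟩

/-- The dg algebra generated by `G` under the additional operations, relative to a family of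
interpretations. -/
noncomputable def free : DGAlg K := (values M).obj

/-- The canonical homomorphism to a member of the family. -/
noncomputable def π (i : I) : free M ⟶ (M i).alg := (values M).π i

variable {M}

lemma free_ext {n : ℤ} {a b : (free M).cx.X n} (h : ∀ i, app (π M i) n a = app (π M i) n b) :
    a = b :=
  (values M).obj_ext h

variable (M)

/-- The generators. -/
noncomputable def ι {n : ℤ} (g : G n) : (free M).cx.X n :=
  (values M).elt (fun i => (M i).gen g) ⟨.gen g, fun _ => trivial, rfl⟩

@[simp]
lemma app_π_ι (i : I) {n : ℤ} (g : G n) : app (π M i) n (ι M g) = (M i).gen g :=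
  (values M).app_π_elt _ _ i

/-- The element `c` is the value of one valid term `t`, the same in all models; the domain
hypothesis is exactly what makes `Term.op t e` valid. -/
lemma exists_op {n : ℤ} (c : (free M).cx.X (n + 1)) (e : E n)
    (h : ∀ i, (M i).dom (app (π M i) (n + 1) c) e) :
    ∃ c' : (free M).cx.X n, ∀ i, app (π M i) n c' = (M i).op (app (π M i) (n + 1) c) e := by
  obtain ⟨t, ht, htc⟩ := (values M).app_π_mem c
  have htc' : ∀ i, t.eval (M i) = app (π M i) (n + 1) c := fun i => congr_fun htc i
  refine ⟨(values M).elt (fun i => (Term.op t e).eval (M i)) ⟨.op t e, fun i => ⟨ht i, ?_⟩, rfl⟩,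
    fun i => ?_⟩
  · rw [htc']
    exact h i
  · rw [← htc']
    exact (values M).app_π_elt _ _ i

open Classical in
/-- The additional operations. -/
noncomputable def freeOp {n : ℤ} (c : (free M).cx.X (n + 1)) (e : E n) : (free M).cx.X n :=
  -- The value 0 outside the common domain is a dummy.
  if h : ∀ i, (M i).dom (app (π M i) (n + 1) c) e then (exists_op M c e h).choose else 0

lemma app_π_freeOp {n : ℤ} (c : (free M).cx.X (n + 1)) (e : E n)
    (h : ∀ i, (M i).dom (app (π M i) (n + 1) c) e) (i : I) :
    app (π M i) n (freeOp M c e) = (M i).op (app (π M i) (n + 1) c) e := by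
  rw [freeOp, dif_pos h]
  exact (exists_op M c e h).choose_spec i

variable {M}

/-- Every element is the value of a valid term, so this is structural induction on terms; validity
supplies the domain condition in the case `op`. -/
lemma free_induction {P : ∀ n, (free M).cx.X n → Prop} (gen : ∀ n (g : G n), P n (ι M g))
    (one : P 0 (free M).one) (zero : ∀ n, P n 0) (add : ∀ n a b, P n a → P n b → P n (a + b))
    (smul : ∀ n (r : K) a, P n a → P n (r • a))
    (mul : ∀ m n k (h : m + n = k) a b, P m a → P n b → P k ((free M).mul h a b))
    (d : ∀ n a, P n a → P (n + 1) ((free M).δ n (n + 1) a))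
    (op : ∀ n a (e : E n), P (n + 1) a → (∀ i, (M i).dom (app (π M i) (n + 1) a) e) →
      P n (freeOp M a e)) (n : ℤ) (a : (free M).cx.X n) : P n a := by
  suffices H : ∀ n (t : Term K G E n), (∀ i, t.Valid (M i)) → ∀ a : (free M).cx.X n,
      (∀ i, app (π M i) n a = t.eval (M i)) → P n a by
    obtain ⟨t, ht, hta⟩ := (values M).app_π_mem a
    exact H n t ht a fun i => (congr_fun hta i).symm
  have key : ∀ {n} (t : Term K G E n) (_ : ∀ i, t.Valid (M i)),
      ∃ a : (free M).cx.X n, ∀ i, app (π M i) n a = t.eval (M i) := fun t ht =>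
    ⟨(values M).elt (fun i => t.eval (M i)) ⟨t, ht, rfl⟩, (values M).app_π_elt _ _⟩
  intro n t
  induction t with
  | gen g =>
    intro _ a ha
    obtain rfl : a = ι M g := free_ext fun i => by rw [ha, app_π_ι]; rfl
    exact gen _ g
  | one =>
    intro _ a ha
    obtain rfl : a = (free M).one := free_ext fun i => by rw [ha, app_one]; rfl
    exact one
  | zero =>
    intro _ a ha
    obtain rfl : a = 0 := free_ext fun i => by rw [ha, map_zero]; rfl
    exact zero _
  | add s t hs ht =>
    intro hv a ha
    obtain ⟨b, hb⟩ := key s fun i => (hv i).1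
    obtain ⟨c, hc⟩ := key t fun i => (hv i).2
    obtain rfl : a = b + c := free_ext fun i => by rw [ha, map_add, hb, hc]; rfl
    exact add _ _ _ (hs (fun i => (hv i).1) b hb) (ht (fun i => (hv i).2) c hc)
  | smul r t ht =>
    intro hv a ha
    obtain ⟨b, hb⟩ := key t hv
    obtain rfl : a = r • b := free_ext fun i => by rw [ha, map_smul, hb]; rfl
    exact smul _ _ _ (ht hv b hb)
  | mul h s t hs ht =>
    intro hv a ha
    obtain ⟨b, hb⟩ := key s fun i => (hv i).1
    obtain ⟨c, hc⟩ := key t fun i => (hv i).2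
    obtain rfl : a = (free M).mul h b c := free_ext fun i => by rw [ha, app_mul, hb, hc]; rfl
    exact mul _ _ _ h _ _ (hs (fun i => (hv i).1) b hb) (ht (fun i => (hv i).2) c hc)
  | d t ht =>
    intro hv a ha
    obtain ⟨b, hb⟩ := key t hv
    obtain rfl : a = (free M).δ _ _ b := free_ext fun i => by rw [ha, app_δ, hb]; rfl
    exact d _ _ (ht hv b hb)
  | op t e ht =>
    intro hv a ha
    obtain ⟨b, hb⟩ := key t fun i => (hv i).1
    have hdom : ∀ i, (M i).dom (app (π M i) _ b) e := fun i => by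
      rw [hb]
      exact (hv i).2
    obtain rfl : a = freeOp M b e := free_ext fun i => by
      rw [ha, app_π_freeOp M b e hdom, hb]
      rfl
    exact op _ _ e (ht (fun i => (hv i).1) b hb) hdom

/-- Two homomorphisms on a free algebra that agree on generators and are compatible on operations
agree. -/
lemma free_hom_ext {Z : DGAlg K} {f g : free M ⟶ Z}
    (gen : ∀ n (x : G n), app f n (ι M x) = app g n (ι M x))
    (op : ∀ n a (e : E n), app f (n + 1) a = app g (n + 1) a →
      (∀ i, (M i).dom (app (π M i) (n + 1) a) e) →
      app f n (freeOp M a e) = app g n (freeOp M a e)) : f = g :=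
  hom_ext <| free_induction gen (by rw [app_one, app_one]) (fun n => by rw [map_zero, map_zero])
    (fun n a b ha hb => by rw [map_add, map_add, ha, hb])
    (fun n r a ha => by rw [map_smul, map_smul, ha])
    (fun m n k h a b ha hb => by rw [app_mul, app_mul, ha, hb])
    (fun n a ha => by rw [app_δ, app_δ, ha]) op

/-- The homomorphism to a free algebra given by compatible families of homomorphisms whose values
are generators. -/
noncomputable def homFree {A : DGAlg K} (f : ∀ i, A ⟶ (M i).alg) (g : ∀ n, A.cx.X n → G n)
    (h : ∀ i n a, (M i).gen (g n a) = app (f i) n a) : A ⟶ free M :=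
  -- Additivity, multiplicativity and the like need not be imposed on the generators: they hold in
  -- each model because each `f i` is a homomorphism.
  (values M).lift f fun n a => ⟨.gen (g n a), fun _ => trivial, funext fun i => h i n a⟩

@[simp]
lemma homFree_π {A : DGAlg K} (f : ∀ i, A ⟶ (M i).alg) (g : ∀ n, A.cx.X n → G n)
    (h : ∀ i n a, (M i).gen (g n a) = app (f i) n a) (i : I) : homFree f g h ≫ π M i = f i :=
  (values M).lift_π _ _ i

lemma app_homFree {A : DGAlg K} (f : ∀ i, A ⟶ (M i).alg) (g : ∀ n, A.cx.X n → G n)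
    (h : ∀ i n a, (M i).gen (g n a) = app (f i) n a) (n : ℤ) (a : A.cx.X n) :
    app (homFree f g h) n a = ι M (g n a) :=
  free_ext fun i => by
    rw [← app_comp, homFree_π, app_π_ι, h]

end Interp

end Terms

/-! ### Quasi-isomorphisms and fillers, elementwise -/

section QuasiIso

/-- Cycles surject onto homology and homology embeds into the opcycles, so equality of classes can
be tested modulo boundaries. The two conditions are surjectivity and injectivity on homology. -/
lemma quasiIso_iff_of_moduleCat {R : Type u} [Ring R] {S T : ShortComplex (ModuleCat.{u} R)}
    (φ : S ⟶ T) : ShortComplex.QuasiIso φ ↔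
      (∀ y : T.X₂, T.g y = 0 → ∃ x : S.X₂, S.g x = 0 ∧ ∃ z : T.X₁, φ.τ₂ x = y + T.f z) ∧
      (∀ x : S.X₂, S.g x = 0 → ∀ y : T.X₁, φ.τ₂ x = T.f y → ∃ x' : S.X₁, S.f x' = x) := by
  have key : ∀ (S : ShortComplex (ModuleCat.{u} R)), ∃ cl : LinearMap.ker S.g.hom → S.homology,
      Function.Surjective cl ∧ ∀ x, S.homologyι (cl x) = S.pOpcycles x.1 := fun S => by
    refine ⟨fun x => S.homologyπ (S.moduleCatCyclesIso.inv x), ?_, fun x => ?_⟩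
    · have h₁ := (ModuleCat.epi_iff_surjective S.homologyπ).1 inferInstance
      have h₂ := (ModuleCat.epi_iff_surjective S.moduleCatCyclesIso.inv).1 inferInstance
      exact h₁.comp h₂
    · have h₁ := congr($(S.homology_π_ι).hom (S.moduleCatCyclesIso.inv x))
      have h₂ := congr($(S.moduleCatCyclesIso_inv_iCycles).hom x)
      refine h₁.trans ?_
      exact congr_arg S.pOpcycles.hom h₂
  obtain ⟨clS, hclS, hS⟩ := key S
  obtain ⟨clT, hclT, hT⟩ := key T
  have hmap : ∀ x y, ShortComplex.homologyMap φ (clS x) = clT y ↔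
      ∃ z : T.X₁, T.f z = φ.τ₂ x.1 - y.1 := fun x y => by
    have inj := (ModuleCat.mono_iff_injective T.homologyι).1 inferInstance
    rw [← inj.eq_iff, hT]
    have h₁ := congr($(ShortComplex.homologyι_naturality φ).hom (clS x))
    have h₂ := congr($(ShortComplex.p_opcyclesMap φ).hom x.1)
    have h₃ : T.homologyι (ShortComplex.homologyMap φ (clS x)) = T.pOpcycles (φ.τ₂ x.1) := by
      refine h₁.trans ?_
      refine Eq.trans ?_ h₂
      exact congr_arg (ShortComplex.opcyclesMap φ).hom (hS x)
    rw [h₃, ShortComplex.moduleCat_pOpcycles_eq_iff]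
    rfl
  have hzero : ∀ x, clS x = 0 ↔ ∃ z : S.X₁, S.f z = x.1 := fun x => by
    have inj := (ModuleCat.mono_iff_injective S.homologyι).1 inferInstance
    rw [← inj.eq_iff, hS, map_zero, ShortComplex.moduleCat_pOpcycles_eq_zero_iff]
    rfl
  have hT0 : clT 0 = 0 := by
    have inj := (ModuleCat.mono_iff_injective T.homologyι).1 inferInstance
    apply inj
    rw [hT]
    simp
  rw [ShortComplex.quasiIso_iff, isIso_iff_mono_and_epi, ModuleCat.mono_iff_injective,
    ModuleCat.epi_iff_surjective, and_comm]
  refine and_congr ⟨fun h y hy => ?_, fun h c => ?_⟩ ⟨fun h x hx y hxy => ?_, fun h => ?_⟩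
  · obtain ⟨c, hc⟩ := h (clT ⟨y, hy⟩)
    obtain ⟨x, rfl⟩ := hclS c
    obtain ⟨z, hz⟩ := (hmap x _).1 hc
    exact ⟨x.1, x.2, z, by rw [hz]; simp⟩
  · obtain ⟨y, rfl⟩ := hclT c
    obtain ⟨x, hx, z, hz⟩ := h y.1 y.2
    exact ⟨clS ⟨x, hx⟩, (hmap _ _).2 ⟨z, by rw [hz]; simp⟩⟩
  · refine (hzero ⟨x, hx⟩).1 (h ?_)
    rw [map_zero, ← hT0, hmap]
    exact ⟨y, by simp [hxy]⟩
  · refine (injective_iff_map_eq_zero _).2 fun c hc => ?_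
    obtain ⟨x, rfl⟩ := hclS c
    rw [← hT0, hmap] at hc
    obtain ⟨z, hz⟩ := hc
    refine (hzero x).2 (h x.1 x.2 z ?_)
    rw [hz]
    simp

variable {K : Type u} [CommRing K] {A B : DGAlg K}

lemma quasiIsos_iff (f : A ⟶ B) : quasiIsos K f ↔
    (∀ n (y : B.cx.X (n + 1)), B.δ (n + 1) (n + 1 + 1) y = 0 →
      ∃ x : A.cx.X (n + 1), A.δ (n + 1) (n + 1 + 1) x = 0 ∧
        ∃ z : B.cx.X n, app f (n + 1) x = y + B.δ n (n + 1) z) ∧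
    (∀ n (x : A.cx.X (n + 1)), A.δ (n + 1) (n + 1 + 1) x = 0 → ∀ y : B.cx.X n,
      app f (n + 1) x = B.δ n (n + 1) y → ∃ x' : A.cx.X n, A.δ n (n + 1) x' = x) := by
  have h₀ : quasiIsos K f ↔ ∀ n, QuasiIsoAt ((toComplex K).map f) n :=
    (HomologicalComplex.mem_quasiIso_iff _).trans (quasiIso_iff _)
  -- Shifting the degree by one makes the preceding degree `n` rather than a subtraction.
  have h₁ : (∀ n, QuasiIsoAt ((toComplex K).map f) n) ↔
      ∀ n, QuasiIsoAt ((toComplex K).map f) (n + 1) :=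
    ⟨fun h n => h _, fun h n => by simpa using h (n - 1)⟩
  rw [h₀, h₁, ← forall_and]
  refine forall_congr' fun n => ?_
  rw [quasiIsoAt_iff' _ n (n + 1) (n + 1 + 1) (by simp) (by simp)]
  exact quasiIso_iff_of_moduleCat _

/-- A homomorphism has *fillers* if it is surjective in a given degree relative to prescribed
differentials; these are ignored when `w` is false. -/
def HasFillers (w : Prop) (f : A ⟶ B) : Prop :=
  ∀ n (x : A.cx.X (n + 1)) (y : B.cx.X n),
    (w → A.δ (n + 1) (n + 1 + 1) x = 0 ∧ app f (n + 1) x = B.δ n (n + 1) y) →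
      ∃ x' : A.cx.X n, app f n x' = y ∧ (w → A.δ n (n + 1) x' = x)

lemma hasFillers_false_iff (f : A ⟶ B) : HasFillers False f ↔ surjections K f := by
  refine ⟨fun h n y => ?_, fun h n x y _ => ?_⟩
  · obtain ⟨x, hx, -⟩ := h n 0 y False.elim
    exact ⟨x, hx⟩
  · obtain ⟨x, hx⟩ := h n y
    exact ⟨x, hx, False.elim⟩

/-- Filling with `x = 0` lifts cycles to cycles; a general `y` is lifted by first lifting the cycle
`δ y` and then filling. Conversely, injectivity on cohomology gives a primitive of `x`, whose image
is corrected by a cycle and a boundary. -/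
lemma hasFillers_true_iff (f : A ⟶ B) :
    HasFillers True f ↔ (quasiIsos K ⊓ surjections K) f := by
  refine ⟨fun h => ?_, fun ⟨hq, hs⟩ n x y hxy => ?_⟩
  · have hc : ∀ n (y : B.cx.X n), B.δ n (n + 1) y = 0 →
        ∃ x : A.cx.X n, app f n x = y ∧ A.δ n (n + 1) x = 0 := fun n y hy => by
      obtain ⟨x, hx, hx'⟩ := h n 0 y fun _ => by simp [hy]
      exact ⟨x, hx, hx' trivial⟩
    refine ⟨(quasiIsos_iff f).2 ⟨fun n y hy => ?_, fun n x hx y hxy => ?_⟩, fun n y => ?_⟩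
    · obtain ⟨x, hx, hx'⟩ := hc (n + 1) y hy
      exact ⟨x, hx', 0, by simp [hx]⟩
    · obtain ⟨x', -, hx'⟩ := h n x y fun _ => ⟨hx, hxy⟩
      exact ⟨x', hx' trivial⟩
    · obtain ⟨z, hz, hz'⟩ := hc (n + 1) (B.δ n (n + 1) y) (B.δ_δ _ _ _ _)
      obtain ⟨x, hx, -⟩ := h n z y fun _ => ⟨hz', hz⟩
      exact ⟨x, hx⟩
  · obtain ⟨hq₁, hq₂⟩ := (quasiIsos_iff f).1 hq
    obtain ⟨hx, hxy⟩ := hxy trivial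
    obtain ⟨x₀, rfl⟩ := hq₂ n x hx y hxy
    obtain ⟨m, rfl⟩ : ∃ m, n = m + 1 := ⟨n - 1, by omega⟩
    -- The error `y - app f _ x₀` is a cycle, hence the image of a cycle `x₁` up to a boundary, and
    -- that boundary lifts by surjectivity.
    obtain ⟨x₁, hx₁, z, hz⟩ := hq₁ m (y - app f _ x₀) (by rw [map_sub, ← app_δ, hxy, sub_self])
    obtain ⟨v, hv⟩ : ∃ v, app f m v = z := hs m z
    refine ⟨x₀ + x₁ - A.δ m (m + 1) v, ?_, fun _ => ?_⟩
    · rw [map_sub, map_add, app_δ, hv, hz]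
      abel
    · rw [map_sub, map_add, hx₁, δ_δ, add_zero, sub_zero]

end QuasiIso

/-! ### Finite limits and colimits, pullbacks and the zero algebra -/

section Limits

open Limits

variable {K : Type u} [CommRing K]

/-- Compatible families of elements of a diagram of dg algebras. -/
def compatible {J : Type} [SmallCategory J] (F : J ⥤ DGAlg K) : SubProduct F.obj where
  carrier n :=
    { carrier := {s | ∀ ⦃i j : J⦄ (φ : i ⟶ j), app (F.map φ) n (s i) = s j}
      add_mem' := fun hs ht i j φ => by simp [hs φ, ht φ]
      zero_mem' := fun i j φ => by simp
      smul_mem' := fun r s hs i j φ => by simp [hs φ] }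
  small n := small_of_injective Subtype.val_injective
  d_mem hs i j φ := by
    rw [app_δ, hs φ]
  mul_mem h s t hs ht i j φ := by
    rw [app_mul, hs φ, ht φ]
  one_mem i j φ := app_one _

instance : HasFiniteLimits (DGAlg K) where
  out J _ _ :=
    { has_limit F := ⟨⟨
        { cone :=
            { pt := (compatible F).obj
              π :=
                { app := (compatible F).π
                  naturality i j φ := hom_ext fun n a => ((compatible F).app_π_mem a φ).symm } }
          isLimit :=
            { lift s := (compatible F).lift s.π.app fun n a i j φ => by
                rw [← app_comp, s.w]
              fac s j := (compatible F).lift_π _ _ j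
              uniq s m hm := (compatible F).hom_obj_ext fun j =>
                (hm j).trans ((compatible F).lift_π _ _ j).symm } }⟩⟩ }

/-- A cocone as an interpretation of the elements of the diagram. -/
def coconeInterp {J : Type} [SmallCategory J] (F : J ⥤ DGAlg K) (s : Cocone F) :
    Interp K (fun n => Σ j, (F.obj j).cx.X n) (fun _ => PEmpty) where
  alg := s.pt
  gen x := app (s.ι.app x.1) _ x.2
  op _ e := e.elim
  dom _ e := e.elim

section Colimits

variable {J : Type} [SmallCategory J] (F : J ⥤ DGAlg K)

/-- The homomorphism from the free algebra relative to all cocones to the point of a cocone. -/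
noncomputable def colimitDesc (s : Cocone F) : Interp.free (coconeInterp F) ⟶ s.pt :=
  Interp.π (coconeInterp F) s

/-- The homomorphisms from the diagram to the free algebra relative to all cocones. -/
noncomputable def colimitι (j : J) : F.obj j ⟶ Interp.free (coconeInterp F) :=
  Interp.homFree (M := coconeInterp F) (fun s => s.ι.app j) (fun _ a => ⟨j, a⟩) fun _ _ _ => rfl

lemma colimitι_desc (j : J) (s : Cocone F) : colimitι F j ≫ colimitDesc F s = s.ι.app j :=
  Interp.homFree_π (M := coconeInterp F) _ _ _ s

lemma app_colimitι (j : J) (n : ℤ) (a : (F.obj j).cx.X n) :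
    app (colimitι F j) n a = Interp.ι (coconeInterp F) ⟨j, a⟩ :=
  Interp.app_homFree (M := coconeInterp F) _ _ _ n a

/-- Equality in the free algebra is tested in every cocone, where it is the cocone condition. -/
lemma map_colimitι {i j : J} (φ : i ⟶ j) : F.map φ ≫ colimitι F j = colimitι F i :=
  hom_ext fun n a => Interp.free_ext fun s => by
    change app ((F.map φ ≫ colimitι F j) ≫ colimitDesc F s) n a =
      app (colimitι F i ≫ colimitDesc F s) n a
    rw [Category.assoc, colimitι_desc, colimitι_desc, s.w]

/-- The free algebra relative to all cocones as a cocone. -/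
noncomputable def colimitCocone : Cocone F where
  pt := Interp.free (coconeInterp F)
  ι :=
    { app := colimitι F
      naturality _ _ φ := (map_colimitι F φ).trans (Category.comp_id _).symm }

/-- The free algebra relative to all cocones is the colimit. -/
noncomputable def isColimitColimitCocone : IsColimit (colimitCocone F) where
  desc s := colimitDesc F s
  fac s j := colimitι_desc F j s
  uniq s m hm := by
    let m' : Interp.free (coconeInterp F) ⟶ s.pt := m
    have hm' : ∀ j, colimitι F j ≫ m' = s.ι.app j := hm
    change m' = _
    refine Interp.free_hom_ext (fun n x => ?_) fun _ _ e => e.elim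
    obtain ⟨j, a⟩ := x
    rw [← app_colimitι, ← app_comp, ← app_comp, hm', colimitι_desc]

end Colimits

instance : HasFiniteColimits (DGAlg K) where
  out _ _ _ := { has_colimit F := ⟨⟨colimitCocone F, isColimitColimitCocone F⟩⟩ }

lemma exists_pullback {X Y C : DGAlg K} (p : X ⟶ Y) (g : C ⟶ Y) :
    ∃ (P : DGAlg K) (a : P ⟶ X) (b : P ⟶ C), a ≫ p = b ≫ g ∧
      (∀ n x c, app p n x = app g n c → ∃ z, app a n z = x ∧ app b n z = c) ∧
      (∀ n z z', app a n z = app a n z' → app b n z = app b n z' → z = z') ∧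
      ∀ (Z : DGAlg K) (s : Z ⟶ X) (t : Z ⟶ C), s ≫ p = t ≫ g →
        ∃ l : Z ⟶ P, l ≫ a = s ∧ l ≫ b = t := by
  let F : Bool → DGAlg K := fun i => Bool.rec C X i
  let S : SubProduct F :=
    { carrier n := LinearMap.ker
        (app p n ∘ₗ LinearMap.proj (φ := fun i => (F i).cx.X n) true -
          app g n ∘ₗ LinearMap.proj (φ := fun i => (F i).cx.X n) false)
      small n := small_of_injective Subtype.val_injective
      d_mem {n s} hs := by
        have hs : app p n (s true) = app g n (s false) := sub_eq_zero.1 hs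
        refine sub_eq_zero.2 ?_
        change app p _ (X.δ _ _ (s true)) = app g _ (C.δ _ _ (s false))
        rw [app_δ, app_δ, hs]
      mul_mem {m n k} h {s t} hs ht := by
        have hs : app p m (s true) = app g m (s false) := sub_eq_zero.1 hs
        have ht : app p n (t true) = app g n (t false) := sub_eq_zero.1 ht
        refine sub_eq_zero.2 ?_
        change app p _ (X.mul h (s true) (t true)) = app g _ (C.mul h (s false) (t false))
        rw [app_mul, app_mul, hs, ht]
      one_mem := sub_eq_zero.2 ((app_one p).trans (app_one g).symm) }
  refine ⟨S.obj, S.π true, S.π false, hom_ext fun n z => sub_eq_zero.1 (S.app_π_mem z),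
    fun n x c h => ?_,
    fun n z z' h h' => S.obj_ext fun i => by cases i <;> assumption, fun Z s t h => ?_⟩
  · let y : ∀ i, (F i).cx.X n := fun i => Bool.rec c x i
    have hy : y ∈ S.carrier n := sub_eq_zero.2 h
    exact ⟨S.elt y hy, S.app_π_elt y hy true, S.app_π_elt y hy false⟩
  · let y : ∀ i, Z ⟶ F i := fun i => Bool.rec t s i
    have hy : ∀ n a, (fun i => app (y i) n a) ∈ S.carrier n := fun n a =>
      sub_eq_zero.2 (congr_arg (fun q => app q n a) h)
    exact ⟨S.lift y hy, S.lift_π y hy true, S.lift_π y hy false⟩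

lemma exists_zero : ∃ Z : DGAlg K, (∀ n (a b : Z.cx.X n), a = b) ∧
    ∀ A : DGAlg K, Nonempty (A ⟶ Z) := by
  let S : SubProduct (fun i : PEmpty.{1} => (i.elim : DGAlg K)) :=
    { carrier _ := ⊤
      small _ := small_of_injective Subtype.val_injective
      d_mem _ := trivial
      mul_mem _ _ _ _ _ := trivial
      one_mem := trivial }
  exact ⟨S.obj, fun n a b => S.obj_ext fun i => i.elim,
    fun A => ⟨S.lift (fun i => i.elim) fun _ _ => trivial⟩⟩

end Limits

/-! ### The universal factorization with chosen fillers -/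

section Factorization

variable {K : Type u} [CommRing K] {A B : DGAlg K}

/-- A factorization of `f` whose second factor has chosen fillers. -/
structure FillerModel (w : Prop) (f : A ⟶ B) where
  /-- the intermediate dg algebra -/
  alg : DGAlg K
  /-- the first factor -/
  i : A ⟶ alg
  /-- the second factor -/
  p : alg ⟶ B
  fac : i ≫ p = f
  /-- the chosen fillers -/
  op {n : ℤ} : alg.cx.X (n + 1) → B.cx.X n → alg.cx.X n
  app_op {n : ℤ} (x : alg.cx.X (n + 1)) (b : B.cx.X n)
    (h : w → alg.δ (n + 1) (n + 1 + 1) x = 0 ∧ app p (n + 1) x = B.δ n (n + 1) b) :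
    app p n (op x b) = b
  δ_op {n : ℤ} (x : alg.cx.X (n + 1)) (b : B.cx.X n)
    (h : w → alg.δ (n + 1) (n + 1 + 1) x = 0 ∧ app p (n + 1) x = B.δ n (n + 1) b) (hw : w) :
    alg.δ n (n + 1) (op x b) = x

namespace FillerModel

variable {w : Prop} {f : A ⟶ B}

variable (w f)

/-- The model given by the identity. -/
def self : FillerModel w f where
  alg := B
  i := f
  p := 𝟙 B
  fac := Category.comp_id f
  op _ b := b
  app_op _ _ _ := rfl
  δ_op _ _ h hw := (h hw).2.symm

/-- The interpretation underlying a model. -/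
def interp (M : FillerModel w f) : Interp K (fun n => A.cx.X n) (fun n => B.cx.X n) where
  alg := M.alg
  gen a := app M.i _ a
  op := M.op
  dom {n} x b := w → M.alg.δ (n + 1) (n + 1 + 1) x = 0 ∧ app M.p (n + 1) x = B.δ n (n + 1) b

/-- The middle term of the universal factorization. -/
noncomputable abbrev univ : DGAlg K := Interp.free (interp w f)

/-- The homomorphism from the universal factorization to a given one. -/
noncomputable def toModel (M : FillerModel w f) : univ w f ⟶ M.alg := Interp.π (interp w f) M

/-- The first factor of the universal factorization. -/
noncomputable def inl : A ⟶ univ w f :=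
  Interp.homFree (M := interp w f) (fun M => M.i) (fun _ a => a) fun _ _ _ => rfl

/-- The second factor of the universal factorization. -/
noncomputable def proj : univ w f ⟶ B := toModel w f (self w f)

lemma inl_toModel (M : FillerModel w f) : inl w f ≫ toModel w f M = M.i :=
  Interp.homFree_π (M := interp w f) _ _ _ M

lemma app_toModel_freeOp (M : FillerModel w f) {n : ℤ} (c : (univ w f).cx.X (n + 1))
    (b : B.cx.X n) (h : ∀ M, (interp w f M).dom (app (toModel w f M) (n + 1) c) b) :
    app (toModel w f M) n (Interp.freeOp (interp w f) c b) =
      M.op (app (toModel w f M) (n + 1) c) b :=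
  Interp.app_π_freeOp _ _ _ h M

lemma inl_proj : inl w f ≫ proj w f = f := inl_toModel w f (self w f)

lemma app_inl (n : ℤ) (a : A.cx.X n) : app (inl w f) n a = Interp.ι (interp w f) a :=
  Interp.app_homFree (M := interp w f) _ _ _ n a

/-- On generators both sides are `f`; on a filler with parameter `b`, both give `b`. -/
lemma toModel_p (M : FillerModel w f) : toModel w f M ≫ M.p = proj w f := by
  refine Interp.free_hom_ext (fun n a => ?_) fun n a e _ hdom => ?_
  · rw [← app_inl, ← app_comp, ← app_comp, inl_proj, ← Category.assoc, inl_toModel, M.fac]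
  · rw [app_comp, app_toModel_freeOp w f M a e hdom]
    exact (M.app_op _ _ (hdom M)).trans (app_toModel_freeOp w f (self w f) a e hdom).symm

/-- Homomorphisms preserve cycles and `toModel_p` preserves the projection to `B`, so a filling
problem in `univ` is a filling problem in every model. -/
lemma dom_of {n : ℤ} (c : (univ w f).cx.X (n + 1)) (b : B.cx.X n)
    (h : w → (univ w f).δ (n + 1) (n + 1 + 1) c = 0 ∧ app (proj w f) (n + 1) c = B.δ n (n + 1) b)
    (M : FillerModel w f) : (interp w f M).dom (app (toModel w f M) (n + 1) c) b := fun hw => by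
  obtain ⟨h₁, h₂⟩ := h hw
  refine ⟨?_, ?_⟩
  · have := app_δ (toModel w f M) (n + 1) (n + 1 + 1) c
    rw [h₁, map_zero] at this
    exact this.symm
  · rw [← app_comp, toModel_p, h₂]

lemma app_proj_freeOp {n : ℤ} (c : (univ w f).cx.X (n + 1)) (b : B.cx.X n)
    (h : ∀ M, (interp w f M).dom (app (toModel w f M) (n + 1) c) b) :
    app (proj w f) n (Interp.freeOp (interp w f) c b) = b :=
  Interp.app_π_freeOp _ _ _ h (self w f)

lemma δ_freeOp {n : ℤ} (c : (univ w f).cx.X (n + 1)) (b : B.cx.X n)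
    (h : ∀ M, (interp w f M).dom (app (toModel w f M) (n + 1) c) b) (hw : w) :
    (univ w f).δ n (n + 1) (Interp.freeOp (interp w f) c b) = c :=
  Interp.free_ext fun M => by
    rw [app_δ, Interp.app_π_freeOp _ _ _ h M]
    exact M.δ_op _ _ (h M) hw

lemma hasFillers_proj : HasFillers w (proj w f) := fun _ c b h =>
  ⟨Interp.freeOp (interp w f) c b, app_proj_freeOp w f c b (dom_of w f c b h),
    δ_freeOp w f c b (dom_of w f c b h)⟩

open Classical in
/-- The universal factorization maps to every other factorization with fillers; the image of its
chosen fillers can be prescribed. -/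
lemma exists_hom_of_fillers {X : DGAlg K} (i : A ⟶ X) (p : X ⟶ B) (fac : i ≫ p = f)
    (s : ∀ n, X.cx.X (n + 1) → B.cx.X n → X.cx.X n → Prop)
    (h : ∀ n (x : X.cx.X (n + 1)) (b : B.cx.X n),
      (w → X.δ (n + 1) (n + 1 + 1) x = 0 ∧ app p (n + 1) x = B.δ n (n + 1) b) →
      ∃ x' : X.cx.X n, app p n x' = b ∧ (w → X.δ n (n + 1) x' = x) ∧ s n x b x') :
    ∃ r : univ w f ⟶ X, inl w f ≫ r = i ∧ ∀ n (c : (univ w f).cx.X (n + 1)) (b : B.cx.X n),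
      (∀ M, (interp w f M).dom (app (toModel w f M) (n + 1) c) b) →
        s n (app r (n + 1) c) b (app r n (Interp.freeOp (interp w f) c b)) := by
  -- With fillers chosen to satisfy `s`, the algebra `X` belongs to the family of models, and `r` is
  -- the projection to it.
  let M : FillerModel w f :=
    { alg := X
      i := i
      p := p
      fac := fac
      op {n} x b := if hx : _ then (h n x b hx).choose else 0
      app_op {n} x b hx := by
        rw [dif_pos hx]
        exact (h n x b hx).choose_spec.1
      δ_op {n} x b hx hw := by
        rw [dif_pos hx]
        exact (h n x b hx).choose_spec.2.1 hw }
  refine ⟨toModel w f M, inl_toModel w f M, fun n c b hdom => ?_⟩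
  have key : ∀ (x : X.cx.X (n + 1))
      (_ : w → X.δ (n + 1) (n + 1 + 1) x = 0 ∧ app p (n + 1) x = B.δ n (n + 1) b),
      s n x b (M.op x b) := fun x hx => by
    change s n x b (dite _ _ _)
    rw [dif_pos hx]
    exact (h n x b hx).choose_spec.2.2
  rw [app_toModel_freeOp w f M c b hdom]
  exact key _ (hdom M)

/-- A lift is the same as a section of the pullback `b : P ⟶ univ w f` of `q` under `A`. Fillers in
`P` are chosen over the universal ones, so universality produces this section. -/
lemma hasLiftingProperty_inl {X Y : DGAlg K} (q : X ⟶ Y) (hq : HasFillers w q) :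
    HasLiftingProperty (inl w f) q where
  sq_hasLift {t g} sq := by
    obtain ⟨P, a, b, hab, hP, hext, hl⟩ := exists_pullback q g
    obtain ⟨l, hla, hlb⟩ := hl A t (inl w f) sq.w
    obtain ⟨r, hr, hr_op⟩ := exists_hom_of_fillers w f l (b ≫ proj w f)
      (by rw [← Category.assoc, hlb, inl_proj])
      (fun n x e x' => app b _ x' = Interp.freeOp (interp w f) (app b (n + 1) x) e) (by
        intro n x e hx
        have hdom := dom_of w f (app b (n + 1) x) e fun hw => by
          refine ⟨?_, (hx hw).2⟩
          rw [← app_δ, (hx hw).1, map_zero]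
        set c' := Interp.freeOp (interp w f) (app b (n + 1) x) e with hc'
        -- The filler in `P` is a pair: its component in `univ` is the universal filler `c'`, and
        -- `q` provides a component in `X` over the image of `c'`.
        obtain ⟨y, hy, hy'⟩ := hq n (app a (n + 1) x) (app g n c') fun hw => by
          refine ⟨?_, ?_⟩
          · rw [← app_δ, (hx hw).1, map_zero]
          · rw [← app_δ, δ_freeOp w f _ e hdom hw, ← app_comp, hab, app_comp]
        obtain ⟨z, rfl, hz⟩ := hP n y c' hy
        refine ⟨z, ?_, fun hw => hext _ _ _ ?_ ?_, hz⟩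
        · rw [app_comp, hz, hc', app_proj_freeOp w f _ e hdom]
        · rw [app_δ, hy' hw]
        · rw [app_δ, hz, hc', δ_freeOp w f _ e hdom hw])
    -- Both maps agree on generators, and `b` was arranged to send the chosen fillers to the
    -- universal ones.
    have hrb : r ≫ b = 𝟙 _ := by
      refine Interp.free_hom_ext (fun n x => ?_) fun n c e hc hdom => ?_
      · rw [← app_inl, ← app_comp, ← app_comp, ← Category.assoc, hr, hlb, Category.comp_id]
      · have := hr_op n c e hdom
        rw [app_comp] at hc ⊢
        rw [this, hc, app_id, app_id]
    refine ⟨⟨⟨r ≫ a, ?_, ?_⟩⟩⟩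
    · rw [← Category.assoc, hr, hla]
    · rw [Category.assoc, hab, ← Category.assoc, hrb, Category.id_comp]

end FillerModel

end Factorization

/-! ### The mapping path algebra and multiplicative homotopies -/

section MappingPath

variable {K : Type u} [CommRing K] (C : DGAlg K)

/-- The identity of a component, as a map between components of provably equal degrees. -/
def transport (i j : ℤ) : C.cx.X i →ₗ[K] C.cx.X j :=
  if h : i = j then h ▸ LinearMap.id else 0

@[simp]
lemma transport_self (i : ℤ) (x : C.cx.X i) : C.transport i i x = x := by
  simp [transport]

lemma transport_eq_zero {i j : ℤ} (h : i ≠ j) : C.transport i j = 0 := by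
  simp [transport, h]

lemma one_mul' {i : ℤ} (h : 0 + i = i) (a : C.cx.X i) : C.mul h C.one a = a := C.one_mul a

lemma mul_one' {i : ℤ} (h : i + 0 = i) (a : C.cx.X i) : C.mul h a C.one = a := C.mul_one a

variable {C} (φ : C ⟶ C)

namespace MappingPath

/-- The components of the mapping path algebra. -/
abbrev Comp (C : DGAlg K) (n : ℤ) : Type u := C.cx.X n × C.cx.X (n - 1)

/-- The second component of the differential. -/
def dsnd (i i' j' : ℤ) : C.cx.X i × C.cx.X i' →ₗ[K] C.cx.X j' :=
  C.transport i j' ∘ₗ (LinearMap.id - app φ i) ∘ₗ LinearMap.fst K _ _ -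
    C.δ i' j' ∘ₗ LinearMap.snd K _ _

lemma dsnd_apply (i i' j' : ℤ) (x : C.cx.X i) (h : C.cx.X i') :
    dsnd φ i i' j' (x, h) = C.transport i j' (x - app φ i x) - C.δ i' j' h := rfl

/-- The differential. -/
def d (i j : ℤ) : Comp C i →ₗ[K] Comp C j :=
  (C.δ i j ∘ₗ LinearMap.fst K _ _).prod (dsnd φ i (i - 1) (j - 1))

lemma dsnd_d {i j i' j' k' : ℤ} (hi : i = j') (hj : j = k') (x : C.cx.X i) (h : C.cx.X i') :
    dsnd φ j j' k' (C.δ i j x, dsnd φ i i' j' (x, h)) = 0 := by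
  subst hi hj
  simp [dsnd_apply, app_δ, δ_δ]

/-- The second component of the multiplication. -/
def mulsnd {i j i' j' k' : ℤ} (hi : i' + j = k') (hj : i + j' = k') (u : C.cx.X i × C.cx.X i')
    (v : C.cx.X j × C.cx.X j') : C.cx.X k' :=
  C.mul hi u.2 (app φ j v.1) + i.negOnePow • C.mul hj u.1 v.2

lemma mulsnd_mk {i j i' j' k' : ℤ} (hi : i' + j = k') (hj : i + j' = k') (x : C.cx.X i)
    (h : C.cx.X i') (y : C.cx.X j) (g : C.cx.X j') :
    mulsnd φ hi hj (x, h) (y, g) = C.mul hi h (app φ j y) + i.negOnePow • C.mul hj x g := rfl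

/-- Both sides expand to the three terms `a φ(y) φ(z)`, `± x b φ(z)` and `± x y c`; multiplicativity
of `φ` and of the sign makes them match. -/
lemma mulsnd_assoc {i j k i' j' k' ij jk ij' jk' n' : ℤ} (hij : i + j = ij) (hjk : j + k = jk)
    (h₁ : i' + j = ij') (h₂ : i + j' = ij') (h₃ : ij' + k = n') (h₄ : ij + k' = n')
    (h₅ : j' + k = jk') (h₆ : j + k' = jk') (h₇ : i' + jk = n') (h₈ : i + jk' = n')
    (x : C.cx.X i) (a : C.cx.X i') (y : C.cx.X j) (b : C.cx.X j') (z : C.cx.X k) (c : C.cx.X k') :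
    mulsnd φ h₃ h₄ (C.mul hij x y, mulsnd φ h₁ h₂ (x, a) (y, b)) (z, c) =
      mulsnd φ h₇ h₈ (x, a) (C.mul hjk y z, mulsnd φ h₅ h₆ (y, b) (z, c)) := by
  subst hij
  simp only [mulsnd_mk, map_add, LinearMap.add_apply, Units.smul_def, map_zsmul,
    LinearMap.smul_apply, smul_add, app_mul]
  rw [C.mul_assoc h₁ hjk h₃ h₇, C.mul_assoc h₂ h₅ h₃ h₈, C.mul_assoc rfl h₆ h₄ h₈, smul_smul,
    ← Units.val_mul, ← Int.negOnePow_add, add_assoc]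

/-- Leibniz rule for the second component, where `d (x, a)` has second component `x - φ x - δ a`. In
the contribution of the `x - φ x` terms, `x φ(y)` cancels. Degrees are independent variables tied by
equations, so that `i + 1 - 1` can be replaced by `i`. -/
lemma dsnd_mul {i j k i' j' k' p q r i₁ j₁ : ℤ} (hij : i + j = k) (hp : i = p) (hq : j = q)
    (hr : k = r) (hi : i' + 1 = i) (hj : j' + 1 = j) (hk : k' + 1 = k)
    (h₁ : i' + j = k') (h₂ : i + j' = k') (h₃ : p + j = r) (h₄ : i₁ + j' = r) (h₅ : i' + j₁ = r)
    (h₆ : i + q = r) (hi₁ : i + 1 = i₁) (hj₁ : j + 1 = j₁)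
    (x : C.cx.X i) (a : C.cx.X i') (y : C.cx.X j) (b : C.cx.X j') :
    dsnd φ k k' r (C.mul hij x y, mulsnd φ h₁ h₂ (x, a) (y, b)) =
      mulsnd φ h₃ h₄ (C.δ i i₁ x, dsnd φ i i' p (x, a)) (y, b) +
        i.negOnePow • mulsnd φ h₅ h₆ (x, a) (C.δ j j₁ y, dsnd φ j j' q (y, b)) := by
  subst hp hq hr
  have e₁ := C.δ_mul h₁ hi hj₁ hk a (app φ j y)
  have e₂ := C.δ_mul h₂ hi₁ hj hk x b
  have e₃ : i.negOnePow = -i'.negOnePow := by rw [← hi, Int.negOnePow_succ]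
  have e₄ : i₁.negOnePow = i'.negOnePow := by
    rw [← hi₁, Int.negOnePow_succ, e₃, neg_neg]
  simp only [mulsnd_mk, dsnd_apply, transport_self, map_sub, map_add, LinearMap.sub_apply,
    Units.smul_def, map_zsmul, app_mul, e₁, e₂, app_δ]
  simp only [e₃, e₄]
  rcases Int.even_or_odd i' with h | h
  · simp only [Int.negOnePow_even _ h, Units.val_neg, Units.val_one, neg_smul, one_smul]
    abel
  · simp only [Int.negOnePow_odd _ h, Units.val_neg, Units.val_one, neg_smul, one_smul, neg_neg]
    abel

/-- The multiplication. -/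
def mulPair {i j k : ℤ} (h : i + j = k) : Comp C i →ₗ[K] Comp C j →ₗ[K] Comp C k :=
  LinearMap.mk₂ K
    (fun u v => (C.mul h u.1 v.1, mulsnd φ (k' := k - 1) (by omega) (by omega) u v))
    (fun u u' v => by
      ext
      · simp
      · simp only [mulsnd, Prod.fst_add, Prod.snd_add, map_add, LinearMap.add_apply, smul_add]
        abel)
    (fun c u v => by
      ext
      · simp
      · simp [mulsnd, smul_add, smul_comm c])
    (fun u v v' => by
      ext
      · simp
      · simp only [mulsnd, Prod.fst_add, Prod.snd_add, map_add, smul_add]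
        abel)
    (fun c u v => by
      ext
      · simp
      · simp [mulsnd, smul_add, smul_comm c])

end MappingPath

open MappingPath in
/-- The mapping path algebra of an endomorphism `φ`: a homomorphism to it is a homomorphism to `C`
together with a homotopy from it to its composition with `φ`. -/
def mappingPath : DGAlg K where
  cx :=
    { X n := ModuleCat.of K (Comp C n)
      d i j := ModuleCat.ofHom (d φ i j)
      shape i j h := by
        have h' : i + 1 ≠ j := by simpa using h
        refine ModuleCat.hom_ext (LinearMap.ext fun u => Prod.ext ?_ ?_)
        · change C.δ i j u.1 = 0
          rw [C.δ_eq_zero h']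
          rfl
        · change C.transport i (j - 1) _ - C.δ (i - 1) (j - 1) _ = 0
          rw [C.δ_eq_zero (by omega), C.transport_eq_zero (by omega)]
          simp
      d_comp_d' i j k hij hjk := by
        have hij' : i + 1 = j := hij
        have hjk' : j + 1 = k := hjk
        refine ModuleCat.hom_ext (LinearMap.ext fun u => Prod.ext ?_ ?_)
        · exact C.δ_δ i j k u.1
        · exact dsnd_d φ (by omega) (by omega) u.1 u.2 }
  mul h := mulPair φ h
  one := (C.one, 0)
  one_mul {i} u := Prod.ext (C.one_mul u.1) (by
    change C.mul _ 0 _ + (0 : ℤ).negOnePow • C.mul _ C.one u.2 = u.2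
    rw [C.one_mul', map_zero]
    simp)
  mul_one {i} u := Prod.ext (C.mul_one u.1) (by
    change C.mul _ u.2 (app φ 0 C.one) + i.negOnePow • C.mul _ u.1 0 = u.2
    rw [app_one, C.mul_one', map_zero]
    simp)
  mul_assoc hij hjk h₁ h₂ u v t := Prod.ext (C.mul_assoc hij hjk h₁ h₂ u.1 v.1 t.1)
    (mulsnd_assoc φ hij hjk _ _ _ _ _ _ _ _ u.1 u.2 v.1 v.2 t.1 t.2)
  leibniz {i j k} h u v := Prod.ext (C.leibniz h u.1 v.1)
    (dsnd_mul φ (p := i + 1 - 1) (q := j + 1 - 1) (r := k + 1 - 1) h (by omega) (by omega)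
      (by omega) (by omega) (by omega) (by omega) _ _ _ _ _ _ rfl rfl u.1 u.2 v.1 v.2)

open MappingPath

/-- The projection from the mapping path algebra. -/
def mappingPathProj : mappingPath φ ⟶ C :=
  ofLinear (fun _ => LinearMap.fst K _ _) (fun _ _ => rfl) (fun _ _ _ => rfl) rfl

/-- The constant path on elements fixed by `φ`. -/
def mappingPathConst {A : DGAlg K} (j : A ⟶ C) (h : j ≫ φ = j) : A ⟶ mappingPath φ :=
  ofLinear (A := A) (B := mappingPath φ) (fun n => (app j n).prod 0)
    (fun i a => Prod.ext (app_δ j _ _ a) (by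
      have : app φ i (app j i a) = app j i a := by rw [← app_comp, h]
      change 0 = C.transport i _ (app j i a - app φ i (app j i a)) - C.δ _ _ 0
      simp [this]))
    (fun {i _ _} hij a b => Prod.ext (app_mul j hij a b) (by
      change 0 = C.mul _ 0 _ + i.negOnePow • C.mul _ (app j i a) 0
      simp))
    (Prod.ext (app_one j) rfl)

lemma mappingPathConst_proj {A : DGAlg K} (j : A ⟶ C) (h : j ≫ φ = j) :
    mappingPathConst φ j h ≫ mappingPathProj φ = j := rfl

/-- If `s y = (y, a)` with `y` a cycle, then the second component of `d (s y) = 0` reads `y - φ y -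
δ a = 0`. -/
lemma exists_homotopy (s : C ⟶ mappingPath φ) (hs : s ≫ mappingPathProj φ = 𝟙 C) (m n : ℤ)
    (hmn : m + 1 = n) (y : C.cx.X n) (hy : C.δ n (n + 1) y = 0) :
    ∃ z : C.cx.X m, app φ n y = y + C.δ m n z := by
  have h₁ : (app s n y).1 = y := congr_arg (fun q => app q n y) hs
  have h₂ := app_δ s n (n + 1) y
  rw [hy, map_zero] at h₂
  have h₃ : dsnd φ n (n - 1) (n + 1 - 1) ((app s n y).1, (app s n y).2) = 0 :=
    (congr_arg Prod.snd h₂).symm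
  rw [h₁] at h₃
  -- Freeing the target degree `n + 1 - 1` as `r` lets it be identified with `n`.
  have key : ∀ (m r : ℤ) (_ : n = r) (a : C.cx.X m), dsnd φ n m r (y, a) = 0 →
      ∃ z : C.cx.X m, app φ n y = y + C.δ m n z := by
    rintro m _ rfl a ha
    refine ⟨-a, ?_⟩
    rw [dsnd_apply, transport_self, sub_sub, sub_eq_zero] at ha
    rw [map_neg]
    nth_rewrite 2 [ha]
    abel
  obtain rfl : m = n - 1 := by omega
  exact key _ _ (by omega) _ h₃

end MappingPath

/-! ### Acyclic cofibrations and the model structure -/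

section ModelStructure

open HomotopicalAlgebra

variable {K : Type u} [CommRing K]

/-- The retraction `r` makes `j` injective on cohomology; the homotopy from the identity to `r ≫ j`
makes it surjective. -/
lemma quasiIsos_of_llp_surjections {A C : DGAlg K} (j : A ⟶ C) (hj : (surjections K).llp j) :
    quasiIsos K j := by
  obtain ⟨Z, hZ, hZ'⟩ := exists_zero (K := K)
  let a : A ⟶ Z := (hZ' A).some
  let c : C ⟶ Z := (hZ' C).some
  -- Every map to the zero algebra is surjective, so `𝟙 A` extends along `j`.
  have := hj a fun n z => ⟨0, hZ n _ _⟩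
  have sq₁ : CommSq (𝟙 A) j a c := ⟨hom_ext fun n _ => hZ n _ _⟩
  let r := sq₁.lift
  have hr : j ≫ r = 𝟙 A := sq₁.fac_left
  have hφ : j ≫ r ≫ j = j := by rw [← Category.assoc, hr, Category.id_comp]
  have := hj (mappingPathProj (r ≫ j)) fun n x => ⟨(x, 0), rfl⟩
  -- Since `r ≫ j` fixes the image of `j`, the constant path is defined on `A`; a lift extends it to
  -- a homotopy on `C`.
  have sq₂ : CommSq (mappingPathConst (r ≫ j) j hφ) j (mappingPathProj (r ≫ j)) (𝟙 C) :=
    ⟨by rw [mappingPathConst_proj, Category.comp_id]⟩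
  refine (quasiIsos_iff j).2 ⟨fun n y hy => ?_, fun n x _ y hxy => ⟨app r n y, ?_⟩⟩
  · obtain ⟨z, hz⟩ := exists_homotopy (r ≫ j) sq₂.lift sq₂.fac_right n (n + 1) rfl y hy
    exact ⟨app r (n + 1) y, by rw [← app_δ, hy, map_zero], z, hz⟩
  · rw [← app_δ, ← hxy, ← app_comp, hr, app_id]

lemma exists_factorization_llp_surjections {A B : DGAlg K} (f : A ⟶ B) :
    ∃ (C : DGAlg K) (j : A ⟶ C) (q : C ⟶ B), j ≫ q = f ∧ (surjections K).llp j ∧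
      surjections K q :=
  ⟨_, _, _, FillerModel.inl_proj False f, fun _ _ q hq =>
    FillerModel.hasLiftingProperty_inl False f q ((hasFillers_false_iff q).2 hq),
    (hasFillers_false_iff _).1 (FillerModel.hasFillers_proj False f)⟩

lemma cofibs_of_llp_surjections {A C : DGAlg K} (j : A ⟶ C) (hj : (surjections K).llp j) :
    cofibs K j :=
  fun _ _ q hq => hj q hq.2

instance : (quasiIsos K).HasTwoOutOfThreeProperty := by
  unfold quasiIsos
  infer_instance

instance : (quasiIsos K).IsStableUnderRetracts := by
  unfold quasiIsos
  infer_instance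

instance : (cofibs K).IsStableUnderRetracts := by
  unfold cofibs
  infer_instance

/-- Retract argument: in a factorization `j = i ≫ q`, two-out-of-three makes `q` a surjective
quasi-isomorphism, so `j` lifts against `q` and is a retract of `i`. -/
lemma llp_surjections_of_cofibs_of_quasiIsos {A C : DGAlg K} (j : A ⟶ C) (hj : cofibs K j)
    (hj' : quasiIsos K j) : (surjections K).llp j := by
  obtain ⟨D, i, q, fac, hi, hq⟩ := exists_factorization_llp_surjections j
  have hq' : quasiIsos K q := by
    exact (quasiIsos K).of_precomp i q (quasiIsos_of_llp_surjections i hi) (by rwa [fac])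
  have := hj q ⟨hq', hq⟩
  exact MorphismProperty.of_retract (RetractArrow.ofLeftLiftingProperty fac) hi

instance : (surjections K).IsStableUnderRetracts where
  of_retract {X Y Z W f g} h hg n y := by
    obtain ⟨x, hx⟩ : ∃ x, app g n x = app h.i.right n y := hg n _
    refine ⟨app h.r.left n x, ?_⟩
    change app (h.r.left ≫ f) n x = y
    rw [h.r_w, app_comp, hx]
    exact congr_arg (fun q : Y ⟶ Y => app q n y) h.retract_right

variable (K) in
/-- The model structure with quasi-isomorphisms as weak equivalences and surjections as
fibrations. -/
@[reducible]
def modelCategory : ModelCategory (DGAlg K) where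
  categoryWithFibrations := ⟨surjections K⟩
  categoryWithCofibrations := ⟨cofibs K⟩
  categoryWithWeakEquivalences := ⟨quasiIsos K⟩
  cm2 := inferInstanceAs (quasiIsos K).HasTwoOutOfThreeProperty
  cm3a := inferInstanceAs (quasiIsos K).IsStableUnderRetracts
  cm3b := inferInstanceAs (surjections K).IsStableUnderRetracts
  cm3c := inferInstanceAs (cofibs K).IsStableUnderRetracts
  cm4a i p hi hi' hp := llp_surjections_of_cofibs_of_quasiIsos i hi.mem hi'.mem p hp.mem
  cm4b i p hi hp hp' := hi.mem p ⟨hp'.mem, hp.mem⟩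
  cm5a :=
    { nonempty_mapFactorizationData f := by
        obtain ⟨C, j, q, fac, hj, hq⟩ := exists_factorization_llp_surjections f
        exact ⟨{
          Z := C
          i := j
          p := q
          fac := fac
          hi := ⟨cofibs_of_llp_surjections j hj, quasiIsos_of_llp_surjections j hj⟩
          hp := hq }⟩ }
  cm5b :=
    { nonempty_mapFactorizationData f :=
        ⟨{Z := _
          i := FillerModel.inl True f
          p := FillerModel.proj True f
          fac := FillerModel.inl_proj True f
          hi := fun _ _ q hq =>
            FillerModel.hasLiftingProperty_inl True f q ((hasFillers_true_iff q).2 hq)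
          hp := (hasFillers_true_iff _).1 (FillerModel.hasFillers_proj True f) |>.symm }⟩ }

end ModelStructure

end DGAlg

theorem mainTheorem2 (K : Type u) [CommRing K] :
    ∃ M : HomotopicalAlgebra.ModelCategory (DGAlg K),
      M.categoryWithCofibrations.cofibrations = DGAlg.cofibs K ∧
      M.categoryWithWeakEquivalences.weakEquivalences = DGAlg.quasiIsos K ∧
      M.categoryWithFibrations.fibrations = DGAlg.surjections K :=
  ⟨DGAlg.modelCategory K, rfl, rfl, rfl⟩
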